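/- Let $G$ be a locally compact second countable (lcsc) Hausdorff unimodular group with Haar measure $\lambda$. All probability spaces are standard, and actions are Borel. A probability measure preserving (pmp) action $G\curvearrowright(X,\mu)$ is called free if $\mu$-almost every point has trivial stabilizer. A Borel set $Y\subset X$ is a cross section of a free pmp action $G\curvearrowright(X,\mu)$ if there is a neighborhood $U$ of the identity of $G$ such that the map $U\times Y\to X$, $(g,y)\mapsto gy$, is injective, and $\mu(X\setminus G\cdot Y)=0$. It is co-compact if moreover there is a compact set $K\subset G$ such that $K\cdot Y$ is a $G$-invariant Borel set with $\mu(X\setminus K\cdot Y)=0$. The cross section equivalence relation on $Y$ is $\mathcal R=\{(y,y')\in Y\times Y : Gy=Gy'\}$. The canonical measure on $Y$ is the unique $\mathcal R$-invariant probability measure $\nu$ on $Y$ for which there is a constant $c\in(0,\infty)$ such that, for every Borel neighborhood $U$ of the identity on which $\zeta:U\times Y\to X$, $\zeta(g,y)=gy$, is injective, $\zeta_*(\lambda|_U\times\nu)=c\,\mu|_{U\cdot Y}$. A countable pmp equivalence relation on a standard probability space $(Z,\eta)$ is an equivalence relation $\mathcal S$ on $Z$ that is a Borel subset of $Z\times Z$,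 has countable classes, and is such that every Borel automorphism $\theta$ of $Z$ with $(z,\theta(z))\in\mathcal S$ for all $z\in Z$ preserves $\eta$ (this last property is what "$\eta$ is $\mathcal S$-invariant" means). A countable pmp equivalence relation $\bar{\mathcal R}$ on $(\bar Y,\bar\nu)$ is a (class-bijective) extension of $\mathcal R$ on $(Y,\nu)$ if there is a Borel map $p:\bar Y\to Y$ with $p_*\bar\nu=\nu$ such that, for $\bar\nu$-almost every $\bar y$, $p$ is injective on $[\bar y]_{\bar{\mathcal R}}$ and $p([\bar y]_{\bar{\mathcal R}})=[p(\bar y)]_{\mathcal R}$. Equivalence relations $\mathcal R_1,\mathcal R_2$ on probability spaces $(Y_1,\nu_1),(Y_2,\nu_2)$ are isomorphic if there are co-null Borel sets $A_i\subset Y_i$ and a measure preserving Borel isomorphism $\theta:A_1\to A_2$ such that, for all $y,y'\in A_1$, $(y,y')\in\mathcal R_1$ if and only if $(\theta(y),\theta(y'))\in\mathcal R_2$. Proposition. Let $G\curvearrowright(X,\mu)$ be a free pmp action, let $Y\subset X$ be a co-compact cross section, let $\mathcal R$ be its cross section equivalence relation and let $\nu$ be the canonical $\mathcal R$-invariant probability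 measure on $Y$. Let $\bar{\mathcal R}$ be a countable pmp equivalence relation on a standard probability space $(\bar Y,\bar\nu)$ which is a class-bijective extension of $\mathcal R$ on $(Y,\nu)$. Then there exist a free pmp action $G\curvearrowright(\tilde X,\tilde\mu)$ on a standard probability space and a co-compact cross section $\tilde Y\subset\tilde X$ such that the cross section equivalence relation $\tilde{\mathcal R}$ on $\tilde Y$, with the canonical $\tilde{\mathcal R}$-invariant probability measure $\tilde\nu$ on $\tilde Y$, is isomorphic to $\bar{\mathcal R}$ on $(\bar Y,\bar\nu)$. -/

import Mathlib

open MeasureTheory Topology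
open scoped Pointwise NNReal

universe u v w

/-- An essentially free, probability measure preserving Borel action of `G` on `(X, μ)`. -/
structure IsFreePMPAction (G : Type*) [Group G] [MeasurableSpace G]
    {X : Type*} [MeasurableSpace X] [MulAction G X] (μ : Measure X) : Prop where
  measurable_smul : Measurable (fun q : G × X => q.1 • q.2)
  isProbabilityMeasure : IsProbabilityMeasure μ
  smul_invariant : SMulInvariantMeasure G X μ
  essentially_free : ∀ᵐ x ∂μ, MulAction.stabilizer G x = ⊥

/-- `Y` is a cross section of the action of `G` on `(X, μ)`. -/
structure IsCrossSection (G : Type*) [Group G] [TopologicalSpace G]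
    {X : Type*} [MeasurableSpace X] [MulAction G X] (μ : Measure X) (Y : Set X) : Prop where
  measurableSet : MeasurableSet Y
  exists_injOn : ∃ U ∈ 𝓝 (1 : G), Set.InjOn (fun q : G × X => q.1 • q.2) (U ×ˢ Y)
  measure_compl : μ ((Set.univ : Set G) • Y)ᶜ = 0

/-- `Y` is a co-compact cross section of the action of `G` on `(X, μ)`. -/
structure IsCocompactCrossSection (G : Type*) [Group G] [TopologicalSpace G]
    {X : Type*} [MeasurableSpace X] [MulAction G X] (μ : Measure X) (Y : Set X) : Prop
    extends IsCrossSection G μ Y where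
  exists_compact : ∃ K : Set G, IsCompact K ∧ MeasurableSet (K • Y) ∧
    (∀ g : G, g • (K • Y) = K • Y) ∧ μ (K • Y)ᶜ = 0

/-- The cross section equivalence relation on `Y`: two points of `Y` are equivalent when they
lie in the same `G`-orbit of `X`. -/
def crossSectionRel (G : Type*) [Group G] {X : Type*} [MulAction G X] (Y : Set X) : Setoid Y :=
  (MulAction.orbitRel G X).comap Subtype.val

/-- `ν` is `r`-invariant: every Borel automorphism moving points inside their `r`-classes
preserves `ν`. -/
def IsInvariantMeasure {Y : Type*} [MeasurableSpace Y] (r : Setoid Y) (ν : Measure Y) : Prop :=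
  ∀ θ : Y ≃ᵐ Y, (∀ y, r (θ y) y) → MeasurePreserving θ ν ν

/-- `r` is a countable pmp (Borel) equivalence relation on the probability space `(Y, ν)`. -/
structure IsCountablePMPRel {Y : Type*} [MeasurableSpace Y] (r : Setoid Y) (ν : Measure Y) :
    Prop where
  isProbabilityMeasure : IsProbabilityMeasure ν
  countable_class : ∀ y, {z | r y z}.Countable
  measurableSet : MeasurableSet {q : Y × Y | r q.1 q.2}
  invariant : IsInvariantMeasure r ν

/-- `ν` is the canonical invariant probability measure on the cross section `Y`, where `lam` is
a Haar measure of `G`: it is invariant under the cross section equivalence relation, and there is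
a constant `c ∈ (0, ∞)` such that the map `(g, y) ↦ g • y` pushes `lam|_U × ν` to `c μ|_{U • Y}`,
for every (Borel) neighbourhood `U` of the identity on which that map is injective. -/
structure IsCanonicalMeasure {G : Type*} [Group G] [TopologicalSpace G] [MeasurableSpace G]
    (lam : Measure G) {X : Type*} [MeasurableSpace X] [MulAction G X] (μ : Measure X)
    (Y : Set X) (ν : Measure Y) : Prop where
  isProbabilityMeasure : IsProbabilityMeasure ν
  invariant : IsInvariantMeasure (crossSectionRel G Y) ν
  exists_const : ∃ c : ℝ≥0, 0 < c ∧ ∀ U ∈ 𝓝 (1 : G), MeasurableSet U →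
    Set.InjOn (fun q : G × X => q.1 • q.2) (U ×ˢ Y) →
    ((lam.restrict U).prod ν).map (fun q : G × Y => q.1 • (q.2 : X)) = c • μ.restrict (U • Y)

/-- The equivalence relation `s` on `(Z, ζ)` is a class-bijective extension of the equivalence
relation `r` on `(Y, ν)`. -/
def IsClassBijectiveExtension {Z Y : Type*} [MeasurableSpace Z] [MeasurableSpace Y]
    (s : Setoid Z) (ζ : Measure Z) (r : Setoid Y) (ν : Measure Y) : Prop :=
  ∃ p : Z → Y, MeasurePreserving p ζ ν ∧
    (∀ᵐ z ∂ζ, Set.InjOn p {z' | s z z'}) ∧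
    (∀ᵐ z ∂ζ, p '' {z' | s z z'} = {y | r (p z) y})

/-- Isomorphism of equivalence relations on probability spaces: a measure preserving Borel
isomorphism between co-null Borel subsets that identifies the two relations there. -/
def AreIsomorphicRel {Z Y : Type*} [MeasurableSpace Z] [MeasurableSpace Y]
    (s : Setoid Z) (ζ : Measure Z) (r : Setoid Y) (ν : Measure Y) : Prop :=
  ∃ (Z₀ : Set Z) (Y₀ : Set Y), MeasurableSet Z₀ ∧ MeasurableSet Y₀ ∧ ζ Z₀ᶜ = 0 ∧ ν Y₀ᶜ = 0 ∧
    ∃ θ : Z₀ ≃ᵐ Y₀,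
      MeasurePreserving θ (ζ.comap Subtype.val) (ν.comap Subtype.val) ∧
      ∀ z z' : Z₀, s z z' ↔ r (θ z) (θ z')

/-! The new space is a fibre product. Let p : Z → Y be the extension map, and let π be a Borel map
from the saturation of Y to Y that moves points inside their G-orbits and fixes Y. Put X' = {(x, z)
: π(x) = p(z)} and let g send (x, z) to (gx, z'), where z' is the unique point of the class of z
lying over π(gx); class-bijectivity provides it. The copy z ↦ (p z, z) of Z meets every orbit in
exactly one class, and it inherits from Y the neighbourhood U, the compact set K and freeness
(`exists_lifted_action`). Since the hypotheses on p hold only almost everywhere, Z is first cut down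
to an invariant conull Borel set on which they hold everywhere (`exists_invariant_conull_set`).

The measure is built locally. If P ⊆ G acts injectively on the cross section Y, then P • Y carries
the image of lam|_P × ν. Two such images agree on overlaps (`localMeasure_eq`): replacing (g, y) by
(g k⁻¹, k y) is, on countably many pieces, a right translation in G above a partial injection inside
the classes. The former preserves lam by unimodularity, the latter preserves ν
(`IsInvariantMeasure.isGraphInvariant`). The glued measure is G-invariant because lam is left
invariant, and finite because K is covered by finitely many translates of a small neighbourhood;
normalising it gives the required probability measure (`exists_invariant_measure_of_crossSection`).
-/

/-! ### Descriptive set theory: Borel sections and Borel graphs. -/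

section Prelim

open Set

/-- A locally compact second countable Hausdorff group is Polish. -/
theorem polishSpace_of_locallyCompact_group (G : Type*) [Group G] [TopologicalSpace G]
    [IsTopologicalGroup G] [T2Space G] [LocallyCompactSpace G] [SecondCountableTopology G] :
    PolishSpace G := by
  let := IsTopologicalGroup.rightUniformSpace G
  have : IsRightUniformGroup G := ⟨rfl⟩
  have : (uniformity G).IsCountablyGenerated := by
    rw [uniformity_eq_comap_nhds_one]
    exact Filter.comap.isCountablyGenerated _ _
  have : CompleteSpace G := IsRightUniformGroup.completeSpace_of_weaklyLocallyCompactSpace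
  let := UniformSpace.metricSpace G
  have : TopologicalSpace.IsCompletelyMetrizableSpace G := inferInstance
  constructor

variable {α β : Type*} [MeasurableSpace α] [MeasurableSpace β] [StandardBorelSpace α]
  [StandardBorelSpace β]

/-- A Borel set with injective first projection contains the graph of a Borel map. -/
theorem exists_measurable_section [Nonempty β] {S : Set (α × β)} (hS : MeasurableSet S)
    (hinj : InjOn Prod.fst S) :
    ∃ k : α → β, Measurable k ∧ ∀ x ∈ Prod.fst '' S, (x, k x) ∈ S := by
  classical
  have hex : ∀ x, ∃ b, x ∈ Prod.fst '' S → (x, b) ∈ S := by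
    intro x
    by_cases hx : x ∈ Prod.fst '' S
    · obtain ⟨⟨x', b⟩, hb, rfl⟩ := hx
      exact ⟨b, fun _ => hb⟩
    · exact ⟨Classical.arbitrary β, fun h => absurd h hx⟩
  choose k₀ hk₀ using hex
  -- Lusin–Souslin: an injective Borel image of a Borel set is Borel. It is applied to the domain
  -- here and to each preimage under the section below.
  have hdom : MeasurableSet (Prod.fst '' S) := hS.image_of_measurable_injOn measurable_fst hinj
  refine ⟨fun x => if x ∈ Prod.fst '' S then k₀ x else Classical.arbitrary β, ?_, ?_⟩
  · intro C hC
    have h1 : MeasurableSet (Prod.fst '' (S ∩ Prod.snd ⁻¹' C)) :=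
      (hS.inter (measurable_snd hC)).image_of_measurable_injOn measurable_fst
        (hinj.mono inter_subset_left)
    have h2 : (fun x => if x ∈ Prod.fst '' S then k₀ x else Classical.arbitrary β) ⁻¹' C
        = Prod.fst '' (S ∩ Prod.snd ⁻¹' C) ∪
          ((Prod.fst '' S)ᶜ ∩ {_x | Classical.arbitrary β ∈ C}) := by
      ext x
      by_cases hx : x ∈ Prod.fst '' S
      · simp only [mem_preimage, mem_union, if_true, mem_inter_iff, mem_compl_iff, hx,
          not_true_eq_false, false_and, or_false]
        constructor
        · intro h
          exact ⟨(x, k₀ x), ⟨hk₀ x hx, h⟩, rfl⟩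
        · rintro ⟨⟨x', b⟩, ⟨hb, hbC⟩, rfl⟩
          have := hinj hb (hk₀ x' hx) rfl
          rw [← (Prod.mk.inj this).2]
          exact hbC
      · have : x ∉ Prod.fst '' (S ∩ Prod.snd ⁻¹' C) := fun h =>
          hx (image_mono inter_subset_left h)
        simp only [mem_preimage, if_false, mem_union, this, mem_inter_iff, mem_compl_iff, hx,
          not_false_eq_true, true_and, false_or, mem_ofPred_eq]
    rw [h2]
    exact h1.union (hdom.compl.inter (MeasurableSet.const _))
  · intro x hx
    simpa only [if_pos hx] using hk₀ x hx

/-- A map between standard Borel spaces with Borel graph is Borel. -/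
theorem measurable_of_measurableSet_graph {f : α → β}
    (hf : MeasurableSet {q : α × β | q.2 = f q.1}) : Measurable f := by
  intro C hC
  have : f ⁻¹' C = Prod.fst '' ({q : α × β | q.2 = f q.1} ∩ Prod.snd ⁻¹' C) := by
    ext x
    constructor
    · intro h
      exact ⟨(x, f x), ⟨rfl, h⟩, rfl⟩
    · rintro ⟨⟨x', b⟩, ⟨hb, hbC⟩, rfl⟩
      simp only [mem_ofPred_eq, mem_preimage] at hb hbC ⊢
      rwa [← hb]
  rw [this]
  refine (hf.inter (measurable_snd hC)).image_of_measurable_injOn measurable_fst ?_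
  rintro ⟨x, b⟩ ⟨hb, -⟩ ⟨x', b'⟩ ⟨hb', -⟩ (rfl : x = x')
  simp only [mem_ofPred_eq] at hb hb'
  rw [hb, hb']

end Prelim

/-! ### Invariance under automorphisms versus partial injections. -/

section Invariance

open Set

variable {Y : Type*} [MeasurableSpace Y]

/-- `ν` is preserved by every Borel partial injection whose graph lies in `r`. -/
def IsGraphInvariant (r : Setoid Y) (ν : Measure Y) : Prop :=
  ∀ E : Set (Y × Y), MeasurableSet E → (∀ q ∈ E, r q.1 q.2) → InjOn Prod.fst E →
    InjOn Prod.snd E → ν (Prod.fst '' E) = ν (Prod.snd '' E)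

variable {r : Setoid Y} {ν : Measure Y}

/-- Graph invariance passes to the pull-back under a relation preserving measurable embedding. -/
theorem IsGraphInvariant.comap (h : IsGraphInvariant r ν) {Z : Type*} [MeasurableSpace Z]
    {s : Setoid Z} {j : Z → Y} (hj : MeasurableEmbedding j) (hs : ∀ a b, s a b → r (j a) (j b)) :
    IsGraphInvariant s (ν.comap j) := by
  intro E hE hEr h1 h2
  have := h (Prod.map j j '' E) ((hj.prodMap hj).measurableSet_image.2 hE)
    (by rintro _ ⟨q, hq, rfl⟩; exact hs _ _ (hEr q hq))
    (by
      rintro _ ⟨q, hq, rfl⟩ _ ⟨q', hq', rfl⟩ hqq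
      rw [h1 hq hq' (hj.injective hqq)])
    (by
      rintro _ ⟨q, hq, rfl⟩ _ ⟨q', hq', rfl⟩ hqq
      rw [h2 hq hq' (hj.injective hqq)])
  rw [hj.comap_apply, hj.comap_apply]
  simpa only [image_image, Prod.map_fst, Prod.map_snd] using this

variable [StandardBorelSpace Y]

theorem IsGraphInvariant.isInvariantMeasure (h : IsGraphInvariant r ν) :
    IsInvariantMeasure r ν := by
  intro θ hθ
  refine ⟨θ.measurable, ?_⟩
  ext C hC
  rw [Measure.map_apply θ.measurable hC]
  have := h {q | q.2 = θ q.1 ∧ q.2 ∈ C}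
    ((measurableSet_eq_fun measurable_snd (θ.measurable.comp measurable_fst)).inter
      (measurable_snd hC))
    (by
      rintro ⟨a, b⟩ ⟨(hb : b = θ a), -⟩
      simpa only [hb] using r.symm (hθ a))
    (by
      rintro ⟨a, b⟩ ⟨(hb : b = θ a), -⟩ ⟨a', b'⟩ ⟨(hb' : b' = θ a'), -⟩ (haa : a = a')
      rw [hb, hb', haa])
    (by
      rintro ⟨a, b⟩ ⟨(hb : b = θ a), -⟩ ⟨a', b'⟩ ⟨(hb' : b' = θ a'), -⟩ (hbb : b = b')
      have : a = a' := θ.injective (by rw [← hb, ← hb', hbb])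
      rw [hbb, this])
  convert this using 2
  · ext a
    constructor
    · intro ha
      exact ⟨(a, θ a), ⟨rfl, ha⟩, rfl⟩
    · rintro ⟨⟨a', b⟩, ⟨(hb : b = θ a'), (hbC : b ∈ C)⟩, rfl⟩
      simpa only [mem_preimage, ← hb] using hbC
  · ext b
    constructor
    · intro hb
      exact ⟨(θ.symm b, b), ⟨by simp, hb⟩, rfl⟩
    · rintro ⟨⟨a', b⟩, ⟨-, (hbC : b ∈ C)⟩, rfl⟩
      exact hbC

/-- The case of partial injections with disjoint domain and range. -/
theorem IsInvariantMeasure.measure_fst_eq_snd_of_disjoint (h : IsInvariantMeasure r ν)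
    {E : Set (Y × Y)} (hE : MeasurableSet E) (hEr : ∀ q ∈ E, r q.1 q.2)
    (h1 : InjOn Prod.fst E) (h2 : InjOn Prod.snd E)
    (hd : Disjoint (Prod.fst '' E) (Prod.snd '' E)) :
    ν (Prod.fst '' E) = ν (Prod.snd '' E) := by
  classical
  set A := Prod.fst '' E with hA
  set B := Prod.snd '' E with hB
  have mA : MeasurableSet A := hE.image_of_measurable_injOn measurable_fst h1
  have mB : MeasurableSet B := hE.image_of_measurable_injOn measurable_snd h2
  -- The graph of an involution of the whole of `Y`: it swaps domain and range along `E` and fixes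
  -- every other point.
  let Γ : Set (Y × Y) := {q | q ∈ E ∨ q.swap ∈ E ∨ (q.2 = q.1 ∧ q.1 ∉ A ∧ q.1 ∉ B)}
  have mΓ : MeasurableSet Γ :=
    hE.union ((measurable_swap hE).union
      ((measurableSet_eq_fun measurable_snd measurable_fst).inter
        ((measurable_fst mA).compl.inter (measurable_fst mB).compl)))
  have memA : ∀ {a b}, (a, b) ∈ E → a ∈ A := fun hab => ⟨_, hab, rfl⟩
  have memB : ∀ {a b}, (a, b) ∈ E → b ∈ B := fun hab => ⟨_, hab, rfl⟩
  have hAB : ∀ {a}, a ∈ A → a ∈ B → False := fun ha hb => (Set.disjoint_left.1 hd) ha hb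
  have hsymm : ∀ {a b}, (a, b) ∈ Γ → (b, a) ∈ Γ := by
    rintro a b (hab | hab | ⟨hab, h3⟩)
    · exact Or.inr (Or.inl hab)
    · exact Or.inl hab
    · refine Or.inr (Or.inr ?_)
      simp only at hab h3 ⊢
      subst hab
      exact ⟨rfl, h3⟩
  have hex : ∀ a, ∃ b, (a, b) ∈ Γ := by
    intro a
    by_cases ha : a ∈ A
    · obtain ⟨⟨a, b⟩, hab, rfl⟩ := ha
      exact ⟨b, Or.inl hab⟩
    by_cases hb : a ∈ B
    · obtain ⟨⟨b, a⟩, hab, rfl⟩ := hb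
      exact ⟨b, Or.inr (Or.inl hab)⟩
    · exact ⟨a, Or.inr (Or.inr ⟨rfl, ha, hb⟩)⟩
  have huniq : ∀ {a b c}, (a, b) ∈ Γ → (a, c) ∈ Γ → b = c := by
    rintro a b c (hab | hab | ⟨hab, h3, h4⟩) (hac | hac | ⟨hac, h5, h6⟩)
    · exact (Prod.mk.inj (h1 hab hac rfl)).2
    · exact (hAB (memA hab) (memB hac)).elim
    · exact (h5 (memA hab)).elim
    · exact (hAB (memA hac) (memB hab)).elim
    · exact (Prod.mk.inj (h2 hab hac rfl)).1
    · exact (h6 (memB hab)).elim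
    · exact (h3 (memA hac)).elim
    · exact (h4 (memB hac)).elim
    · exact hab.trans hac.symm
  choose t ht using hex
  have hgraph : {q : Y × Y | q.2 = t q.1} = Γ := by
    ext ⟨a, b⟩
    constructor
    · rintro (rfl : b = t a)
      exact ht a
    · intro hab
      exact huniq hab (ht a)
  have mt : Measurable t := measurable_of_measurableSet_graph (by rw [hgraph]; exact mΓ)
  have hinv : Function.Involutive t := fun a => huniq (ht (t a)) (hsymm (ht a))
  have hmp := h (MeasurableEquiv.ofInvolutive t hinv mt) (by
    intro a
    rw [MeasurableEquiv.ofInvolutive_apply]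
    rcases ht a with hab | hab | ⟨hab, -⟩
    · exact r.symm (hEr _ hab)
    · exact hEr _ hab
    · simp only at hab
      rw [hab])
  have := hmp.measure_preimage mB.nullMeasurableSet
  rw [← this]
  congr 1
  ext a
  simp only [mem_preimage, MeasurableEquiv.ofInvolutive_apply]
  constructor
  · rintro ⟨⟨a, b⟩, hab, rfl⟩
    have : t a = b := huniq (ht a) (Or.inl hab)
    rw [this]
    exact memB hab
  · intro hb
    obtain ⟨⟨c, b⟩, hab, (hbt : b = t a)⟩ := hb
    subst hbt
    have : a = c := huniq (hsymm (ht a)) (Or.inr (Or.inl hab))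
    rw [this]
    exact memA hab

/-- A partial injection need not extend to an automorphism inside the classes. It is cut into
countably many pieces, each contained in the diagonal or having disjoint domain and range; pieces of
the second kind extend to involutions. -/
theorem IsInvariantMeasure.isGraphInvariant (h : IsInvariantMeasure r ν) :
    IsGraphInvariant r ν := by
  intro E hE hEr h1 h2
  have : StandardBorelSpace E := hE.standardBorel
  obtain ⟨C, mC, hC⟩ := exists_seq_separating Y (p := MeasurableSet) MeasurableSet.univ univ
  have e1 : MeasurableEmbedding (fun q : E => q.1.1) :=
    (measurable_fst.comp measurable_subtype_coe).measurableEmbedding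
      fun a b hab => Subtype.ext (h1 a.2 b.2 hab)
  have e2 : MeasurableEmbedding (fun q : E => q.1.2) :=
    (measurable_snd.comp measurable_subtype_coe).measurableEmbedding
      fun a b hab => Subtype.ext (h2 a.2 b.2 hab)
  have im1 : ∀ F : Set E, (fun q : E => q.1.1) '' F = Prod.fst '' (Subtype.val '' F) :=
    fun F => by rw [image_image]
  have im2 : ∀ F : Set E, (fun q : E => q.1.2) '' F = Prod.snd '' (Subtype.val '' F) :=
    fun F => by rw [image_image]
  -- Phrased as an equality of measures on `E`, the claim can be checked on a countable cover that
  -- need not be disjoint.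
  suffices hm : ν.comap (fun q : E => q.1.1) = ν.comap (fun q : E => q.1.2) by
    have := congrArg (fun m => m univ) hm
    simpa only [e1.comap_apply, e2.comap_apply, im1, im2, image_univ, Subtype.range_coe] using this
  -- `none` is the diagonal; `(n, b)` collects the pairs that `C n` separates, with `b` telling
  -- which coordinate lies in `C n`.
  let S : Option (ℕ × Bool) → Set E := fun i => i.elim {q | q.1.1 = q.1.2}
    (fun j => if j.2 then {q | q.1.1 ∈ C j.1 ∧ q.1.2 ∉ C j.1}
      else {q | q.1.1 ∉ C j.1 ∧ q.1.2 ∈ C j.1})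
  have hS : ⋃ i, S i = univ := by
    refine eq_univ_of_forall fun q => mem_iUnion.2 ?_
    by_cases hq : q.1.1 = q.1.2
    · exact ⟨none, hq⟩
    · have : ¬ ∀ n, q.1.1 ∈ C n ↔ q.1.2 ∈ C n := fun hn => hq (hC _ trivial _ trivial hn)
      push Not at this
      obtain ⟨n, ⟨ha, hb⟩ | ⟨ha, hb⟩⟩ := this
      · exact ⟨some (n, true), by simp [S, ha, hb]⟩
      · exact ⟨some (n, false), by simp [S, ha, hb]⟩
  rw [Measure.ext_iff_of_iUnion_eq_univ hS]
  intro i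
  ext F hF
  rw [Measure.restrict_apply hF, Measure.restrict_apply hF, e1.comap_apply, e2.comap_apply,
    im1, im2]
  rcases i with _ | ⟨n, b⟩
  · congr 1
    rw [← im1, ← im2]
    refine image_congr ?_
    rintro q ⟨-, hq⟩
    exact hq
  · have mS : MeasurableSet (S (some (n, b))) := by
      have ha := e1.measurable (mC n)
      have hb := e2.measurable (mC n)
      cases b
      · exact ha.compl.inter hb
      · exact ha.inter hb.compl
    refine h.measure_fst_eq_snd_of_disjoint
      ((MeasurableEmbedding.subtype_coe hE).measurableSet_image.2 (hF.inter mS)) ?_ ?_ ?_ ?_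
    · rintro _ ⟨q, -, rfl⟩
      exact hEr _ q.2
    · exact h1.mono (by rintro _ ⟨q, -, rfl⟩; exact q.2)
    · exact h2.mono (by rintro _ ⟨q, -, rfl⟩; exact q.2)
    · rw [Set.disjoint_left]
      rintro _ ⟨_, ⟨q, ⟨-, hq⟩, rfl⟩, rfl⟩ ⟨_, ⟨q', ⟨-, hq'⟩, rfl⟩, h3⟩
      cases b
      · simp only [S, Option.elim, Bool.false_eq_true, if_false, mem_ofPred_eq] at hq hq'
        exact hq.1 (h3 ▸ hq'.2)
      · simp only [S, Option.elim, if_true, mem_ofPred_eq] at hq hq'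
        exact hq'.2 (h3 ▸ hq.1)

/-- Graph invariance as a statement about push-forwards under partial injections. -/
theorem IsGraphInvariant.map_restrict (h : IsGraphInvariant r ν) {φ : Y → Y} (hφ : Measurable φ)
    {A : Set Y} (hA : MeasurableSet A) (hinj : InjOn φ A) (hr : ∀ y ∈ A, r y (φ y)) :
    (ν.restrict A).map φ = ν.restrict (φ '' A) := by
  ext C hC
  rw [Measure.map_apply hφ hC, Measure.restrict_apply (hφ hC), Measure.restrict_apply hC]
  have := h {q | q.2 = φ q.1 ∧ q.1 ∈ A ∧ q.2 ∈ C}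
    ((measurableSet_eq_fun measurable_snd (hφ.comp measurable_fst)).inter
      ((measurable_fst hA).inter (measurable_snd hC)))
    (by
      rintro ⟨a, b⟩ ⟨(hb : b = φ a), ha, -⟩
      simpa only [hb] using hr a ha)
    (by
      rintro ⟨a, b⟩ ⟨(hb : b = φ a), -⟩ ⟨a', b'⟩ ⟨(hb' : b' = φ a'), -⟩ (haa : a = a')
      rw [hb, hb', haa])
    (by
      rintro ⟨a, b⟩ ⟨(hb : b = φ a), ha, -⟩ ⟨a', b'⟩ ⟨(hb' : b' = φ a'), ha', -⟩ (hbb : b = b')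
      have : a = a' := hinj ha ha' (by rw [← hb, ← hb', hbb])
      rw [hbb, this])
  convert this using 2
  · ext a
    constructor
    · rintro ⟨haC, ha⟩
      exact ⟨(a, φ a), ⟨rfl, ha, haC⟩, rfl⟩
    · rintro ⟨⟨a', b⟩, ⟨(hb : b = φ a'), ha, (hbC : b ∈ C)⟩, rfl⟩
      exact ⟨by simpa only [mem_preimage, ← hb] using hbC, ha⟩
  · ext b
    constructor
    · rintro ⟨hb, a, ha, rfl⟩
      exact ⟨(a, φ a), ⟨rfl, ha, hb⟩, rfl⟩
    · rintro ⟨⟨a, b⟩, ⟨(hb : b = φ a), ha, (hbC : b ∈ C)⟩, rfl⟩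
      exact ⟨hbC, a, ha, hb.symm⟩

end Invariance

/-! ### Covers of `G` by sets acting injectively on `Y`. -/

section Covers

open Set

theorem injOn_translate_smul {G : Type*} [Group G] {X : Type*} [MulAction G X] {Y : Set X}
    {P : Set G} (h : InjOn (fun q : G × X => q.1 • q.2) (P ×ˢ Y))
    (t : G) :
    InjOn (fun q : G × X => q.1 • q.2) ((t • P) ×ˢ Y) := by
  rintro ⟨g, y⟩ ⟨hg, hy⟩ ⟨g', y'⟩ ⟨hg', hy'⟩ (hgy : g • y = g' • y')
  rw [mem_smul_set_iff_inv_smul_mem] at hg hg'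
  have := @h (t⁻¹ • g, y) ⟨hg, hy⟩ (t⁻¹ • g', y') ⟨hg', hy'⟩ (by
    simp only [smul_eq_mul, mul_smul, hgy])
  simpa using this

variable {G : Type*} [Group G] [TopologicalSpace G] [IsTopologicalGroup G]
  {X : Type*} [MulAction G X] {Y : Set X}

/-- Translates by a dense sequence suffice, since t⁻¹g lies in `U` for t close to g. The
normalisation `t 0 = 1` is there for `exists_borel_selector`, where it makes the selector fix `Y`.
-/
theorem exists_translate_cover [SecondCountableTopology G] {U : Set G} (hU : U ∈ 𝓝 (1 : G)) :
    ∃ t : ℕ → G, t 0 = 1 ∧ ∀ g, ∃ i, g ∈ t i • U := by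
  have : Nonempty G := ⟨1⟩
  refine ⟨fun n => n.casesOn 1 (TopologicalSpace.denseSeq G), rfl, fun g => ?_⟩
  have hV : {t : G | t⁻¹ * g ∈ U} ∈ 𝓝 g := by
    have hc : ContinuousAt (fun t : G => t⁻¹ * g) g := by fun_prop
    exact hc.preimage_mem_nhds (by simpa using hU)
  obtain ⟨V, hVU, hVo, hgV⟩ := mem_nhds_iff.1 hV
  obtain ⟨n, hn⟩ := (TopologicalSpace.denseRange_denseSeq G).exists_mem_open hVo ⟨g, hgV⟩
  refine ⟨n + 1, ?_⟩
  rw [mem_smul_set_iff_inv_smul_mem]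
  exact hVU hn

/-- A countable cover of `G` by sets whose elements act on `Y` in an injective way, as do their
inverses. -/
theorem exists_injOn_cover [SecondCountableTopology G] [MeasurableSpace G] [BorelSpace G]
    {U : Set G} (hU : IsOpen U) (h1 : (1 : G) ∈ U)
    (hinj : InjOn (fun q : G × X => q.1 • q.2) (U ×ˢ Y)) :
    ∃ W : ℕ → Set G, (∀ n, MeasurableSet (W n)) ∧ (∀ g, ∃ n, g ∈ W n) ∧
      ∀ n, ∀ w ∈ W n, ∀ w' ∈ W n, ∀ y ∈ Y, ∀ y' ∈ Y,
        (w • y = w' • y' → w = w' ∧ y = y') ∧ (w⁻¹ • y = w'⁻¹ • y' → w = w' ∧ y = y') := by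
  obtain ⟨t, -, ht⟩ := exists_translate_cover (hU.mem_nhds h1)
  -- The second factor gives injectivity for w, the first for w⁻¹.
  refine ⟨fun n => (t n.unpair.1 • U)⁻¹ ∩ t n.unpair.2 • U, fun n => ?_, fun g => ?_, ?_⟩
  · exact ((hU.smul _).inv.inter (hU.smul _)).measurableSet
  · obtain ⟨i, hi⟩ := ht g⁻¹
    obtain ⟨k, hk⟩ := ht g
    refine ⟨Nat.pair i k, ?_⟩
    simp only [Nat.unpair_pair]
    exact ⟨hi, hk⟩
  · rintro n w ⟨hw1, hw2⟩ w' ⟨hw1', hw2'⟩ y hy y' hy'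
    constructor
    · intro h
      have := injOn_translate_smul hinj (t n.unpair.2) (x₁ := (w, y)) (x₂ := (w', y'))
        ⟨hw2, hy⟩ ⟨hw2', hy'⟩ h
      simpa using this
    · intro h
      have := injOn_translate_smul hinj (t n.unpair.1) (x₁ := (w⁻¹, y)) (x₂ := (w'⁻¹, y'))
        ⟨hw1, hy⟩ ⟨hw1', hy'⟩ h
      simpa using this

end Covers

/-! ### Comparing parametrisations of the same subset of `X`. -/

section Comparison

open Set

/-- Skewing a partial injection by right translations preserves `lam × ν`. -/
theorem measure_image_skew {G : Type*} [Group G] [MeasurableSpace G] [StandardBorelSpace G]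
    [MeasurableMul₂ G] [MeasurableInv G] {lam : Measure G} [SFinite lam] [lam.IsMulRightInvariant]
    {Y : Type*} [MeasurableSpace Y] [StandardBorelSpace Y] {ν : Measure Y} [SFinite ν] {r : Setoid Y}
    (hν : IsGraphInvariant r ν)
    {A : Set Y} {k : Y → G} {φ : Y → Y} (hA : MeasurableSet A) (hk : Measurable k)
    (hφ : Measurable φ) (hinj : InjOn φ A) (hr : ∀ y ∈ A, r y (φ y))
    {E : Set (G × Y)} (hE : MeasurableSet E) (hEA : ∀ q ∈ E, q.2 ∈ A) :
    MeasurableSet ((fun q : G × Y => (q.1 * (k q.2)⁻¹, φ q.2)) '' E) ∧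
    lam.prod ν ((fun q : G × Y => (q.1 * (k q.2)⁻¹, φ q.2)) '' E) = lam.prod ν E := by
  set T : G × Y → G × Y := fun q => (q.1 * (k q.2)⁻¹, φ q.2) with hT
  have hmp1 : MeasurePreserving φ (ν.restrict A) (ν.restrict (φ '' A)) :=
    ⟨hφ, hν.map_restrict hφ hA hinj hr⟩
  -- A skew product over `φ` whose fibre maps are right translations; this is where unimodularity
  -- enters.
  have hmp2 : MeasurePreserving (fun p : Y × G => (φ p.1, p.2 * (k p.1)⁻¹))
      ((ν.restrict A).prod lam) ((ν.restrict (φ '' A)).prod lam) :=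
    hmp1.skew_product (g := fun y g => g * (k y)⁻¹)
      (measurable_snd.mul (hk.comp measurable_fst).inv)
      (Filter.Eventually.of_forall fun y => map_mul_right_eq_self lam (k y)⁻¹)
  have hmp : MeasurePreserving T (lam.prod (ν.restrict A)) (lam.prod (ν.restrict (φ '' A))) :=
    Measure.measurePreserving_swap.comp (hmp2.comp Measure.measurePreserving_swap)
  have hres : ∀ B : Set Y, lam.prod (ν.restrict B) = (lam.prod ν).restrict (univ ×ˢ B) := by
    intro B
    rw [← Measure.prod_restrict, Measure.restrict_univ]
  have iT : InjOn T E := by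
    rintro ⟨g, y⟩ hg ⟨g', y'⟩ hg' h
    obtain ⟨h1, h2⟩ := Prod.mk.inj h
    have hy : y = y' := hinj (hEA _ hg) (hEA _ hg') h2
    subst hy
    have hgg : g = g' := mul_right_cancel h1
    rw [hgg]
  have mTE : MeasurableSet (T '' E) := hE.image_of_measurable_injOn hmp.measurable iT
  refine ⟨mTE, ?_⟩
  have h1 := hmp.measure_preimage mTE.nullMeasurableSet
  rw [hres, hres, Measure.restrict_apply (hmp.measurable mTE), Measure.restrict_apply mTE] at h1
  have h2 : T ⁻¹' (T '' E) ∩ univ ×ˢ A = E := by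
    ext ⟨g, y⟩
    constructor
    · rintro ⟨⟨⟨g', y'⟩, hE', h⟩, -, hy⟩
      obtain ⟨h1, h2⟩ := Prod.mk.inj h
      have hyy : y' = y := hinj (hEA _ hE') hy h2
      subst hyy
      have hgg : g' = g := mul_right_cancel h1
      rwa [← hgg]
    · intro h
      exact ⟨⟨_, h, rfl⟩, trivial, hEA _ h⟩
  have h3 : T '' E ∩ univ ×ˢ (φ '' A) = T '' E := by
    refine inter_eq_left.2 ?_
    rintro _ ⟨q, hq, rfl⟩
    exact ⟨trivial, q.2, hEA q hq, rfl⟩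
  rw [h2, h3] at h1
  exact h1.symm

variable {G : Type*} [Group G] [MeasurableSpace G] [StandardBorelSpace G]
  {X : Type*} [MeasurableSpace X] [StandardBorelSpace X] [MulAction G X] {Y : Set X}

/-- The elements of `W` moving points of `Y` inside `Y` define a Borel partial injection. -/
theorem exists_partial_map (hact : Measurable (fun q : G × X => q.1 • q.2))
    (hY : MeasurableSet Y) {W : Set G} (hW : MeasurableSet W)
    (hinj : ∀ w ∈ W, ∀ w' ∈ W, ∀ y ∈ Y, ∀ y' ∈ Y,
        (w • y = w' • y' → w = w' ∧ y = y') ∧ (w⁻¹ • y = w'⁻¹ • y' → w = w' ∧ y = y')) :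
    ∃ (A : Set Y) (k : Y → G) (φ : Y → Y), MeasurableSet A ∧ Measurable k ∧ Measurable φ ∧
      InjOn φ A ∧ (∀ y ∈ A, (φ y : X) = k y • (y : X)) ∧
      ∀ y : Y, ∀ w ∈ W, w • (y : X) ∈ Y → y ∈ A ∧ k y = w := by
  classical
  have : StandardBorelSpace Y := hY.standardBorel
  have hq : Measurable (fun q : Y × G => q.2 • (q.1 : X)) :=
    hact.comp (measurable_snd.prodMk (measurable_subtype_coe.comp measurable_fst))
  let S : Set (Y × G) := {q | q.2 ∈ W ∧ q.2 • (q.1 : X) ∈ Y}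
  have mS : MeasurableSet S := (measurable_snd hW).inter (hq hY)
  have iS : InjOn Prod.fst S := by
    rintro ⟨y, w⟩ ⟨hw, hwy⟩ ⟨y', w'⟩ ⟨hw', hwy'⟩ (rfl : y = y')
    -- The condition on inverses, applied to the two image points in `Y`, makes w unique for given
    -- y. The other condition will make `φ` injective.
    have := ((hinj w hw w' hw' _ hwy _ hwy').2 (by simp)).1
    rw [this]
  have : Nonempty G := ⟨1⟩
  obtain ⟨k, mk, hk⟩ := exists_measurable_section mS iS
  have mA : MeasurableSet (Prod.fst '' S) := mS.image_of_measurable_injOn measurable_fst iS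
  have hkY : ∀ y ∈ Prod.fst '' S, k y • (y : X) ∈ Y := fun y hy => (hk y hy).2
  let ψ : Y → X := fun y => if y ∈ Prod.fst '' S then k y • (y : X) else y
  have mψ : Measurable ψ :=
    Measurable.ite mA (hq.comp (measurable_id.prodMk mk)) measurable_subtype_coe
  have hψ : ∀ y, ψ y ∈ Y := by
    intro y
    by_cases hy : y ∈ Prod.fst '' S
    · simpa only [ψ, if_pos hy] using hkY y hy
    · simpa only [ψ, if_neg hy] using y.2
  have hψA : ∀ y ∈ Prod.fst '' S, ψ y = k y • (y : X) := fun y hy => if_pos hy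
  refine ⟨Prod.fst '' S, k, fun y => ⟨ψ y, hψ y⟩, mA, mk, mψ.subtype_mk, ?_, hψA, ?_⟩
  · intro y hy y' hy' h
    have h' : ψ y = ψ y' := congrArg Subtype.val h
    rw [hψA y hy, hψA y' hy'] at h'
    exact Subtype.ext ((hinj _ (hk y hy).1 _ (hk y' hy').1 _ y.2 _ y'.2).1 h').2
  · intro y w hw hwy
    have hy : y ∈ Prod.fst '' S := ⟨(y, w), ⟨hw, hwy⟩, rfl⟩
    exact ⟨hy, (Prod.mk.inj (iS (hk y hy) (show (y, w) ∈ S from ⟨hw, hwy⟩) rfl)).2⟩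

variable [MeasurableMul₂ G] [MeasurableInv G] {ν : Measure Y} [SFinite ν] {lam : Measure G} [SFinite lam] [lam.IsMulRightInvariant]

/-- If `A` injects into `X` and its image is covered by that of `A'`, then `A` has the smaller
measure. -/
theorem prod_measure_le_of_image_subset (hact : Measurable (fun q : G × X => q.1 • q.2))
    (hY : MeasurableSet Y) (hν : IsGraphInvariant (crossSectionRel G Y) ν)
    {W : ℕ → Set G} (hW : ∀ n, MeasurableSet (W n)) (hWcov : ∀ g, ∃ n, g ∈ W n)
    (hWinj : ∀ n, ∀ w ∈ W n, ∀ w' ∈ W n, ∀ y ∈ Y, ∀ y' ∈ Y,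
        (w • y = w' • y' → w = w' ∧ y = y') ∧ (w⁻¹ • y = w'⁻¹ • y' → w = w' ∧ y = y'))
    {A A' : Set (G × Y)} (hA : MeasurableSet A) (hA' : MeasurableSet A')
    (hinj : InjOn (fun q : G × Y => q.1 • (q.2 : X)) A)
    (hsub : (fun q : G × Y => q.1 • (q.2 : X)) '' A ⊆ (fun q : G × Y => q.1 • (q.2 : X)) '' A') :
    lam.prod ν A ≤ lam.prod ν A' := by
  have : StandardBorelSpace Y := hY.standardBorel
  choose D k φ mD mk mφ iφ hφ hmem using fun n => exists_partial_map hact hY (hW n) (hWinj n)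
  -- A reparametrisation that does not change the point of `X`: (g k⁻¹) • (k • y) = g • y. If g • y
  -- = h • y' with (h, y') in `A'`, then k = h⁻¹g lies in some `W n`, and `T n` sends (g, y) to (h,
  -- y').
  let T : ℕ → G × Y → G × Y := fun n q => (q.1 * (k n q.2)⁻¹, φ n q.2)
  have mT : ∀ n, Measurable (T n) := fun n =>
    (measurable_fst.mul ((mk n).comp measurable_snd).inv).prodMk ((mφ n).comp measurable_snd)
  let B : ℕ → Set (G × Y) := fun n => A ∩ ({q | q.2 ∈ D n} ∩ T n ⁻¹' A')
  have mB : ∀ n, MeasurableSet (B n) := fun n =>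
    hA.inter ((measurable_snd (mD n)).inter (mT n hA'))
  have hAB : A = ⋃ n, disjointed B n := by
    rw [iUnion_disjointed]
    refine subset_antisymm (fun q hq => ?_) (iUnion_subset fun n => inter_subset_left)
    obtain ⟨g, y⟩ := q
    obtain ⟨⟨h, y'⟩, hq', hqq⟩ := hsub ⟨_, hq, rfl⟩
    simp only at hqq
    obtain ⟨n, hn⟩ := hWcov (h⁻¹ * g)
    have hy' : (h⁻¹ * g) • (y : X) = y' := by rw [mul_smul, ← hqq, inv_smul_smul]
    obtain ⟨hyD, hky⟩ := hmem n y _ hn (by rw [hy']; exact y'.2)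
    refine mem_iUnion.2 ⟨n, hq, hyD, ?_⟩
    have : T n (g, y) = (h, y') := by
      refine Prod.ext ?_ (Subtype.ext ?_)
      · simp [T, hky]
      · change (φ n y : X) = y'
        rw [hφ n y hyD, hky, hy']
    rw [mem_preimage, this]
    exact hq'
  have hsubB : ∀ n, disjointed B n ⊆ B n := fun n => disjointed_subset B n
  have key : ∀ n, MeasurableSet (T n '' disjointed B n) ∧
      lam.prod ν (T n '' disjointed B n) = lam.prod ν (disjointed B n) := fun n =>
    measure_image_skew hν (mD n) (mk n) (mφ n) (iφ n)
      (fun y hy => by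
        refine (crossSectionRel G Y).symm ?_
        exact ⟨k n y, (hφ n y hy).symm⟩)
      (MeasurableSet.disjointed mB n) (fun q hq => (hsubB n hq).2.1)
  have hqT : ∀ n, ∀ q ∈ B n, (T n q).1 • ((T n q).2 : X) = q.1 • (q.2 : X) := by
    intro n q hq
    simp only [T]
    rw [hφ n _ hq.2.1, smul_smul, inv_mul_cancel_right]
  -- Each `T n` keeps the point of `X`, and `A` injects into `X`, so the moved pieces stay disjoint
  -- inside `A'`.
  have hdisj : Pairwise (Function.onFun Disjoint fun n => T n '' disjointed B n) := by
    intro i j hij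
    refine Set.disjoint_left.2 ?_
    rintro _ ⟨a, ha, rfl⟩ ⟨b, hb, hab⟩
    have : a = b := hinj (hsubB i ha).1 (hsubB j hb).1 (by
      simp only
      rw [← hqT i a (hsubB i ha), ← hqT j b (hsubB j hb), hab])
    subst this
    exact Set.disjoint_left.1 (disjoint_disjointed B hij) ha hb
  calc lam.prod ν A = ∑' n, lam.prod ν (disjointed B n) := by
        conv_lhs => rw [hAB]
        exact measure_iUnion (disjoint_disjointed B) fun n => MeasurableSet.disjointed mB n
    _ = ∑' n, lam.prod ν (T n '' disjointed B n) := by simp_rw [(key _).2]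
    _ = lam.prod ν (⋃ n, T n '' disjointed B n) :=
        (measure_iUnion hdisj fun n => (key n).1).symm
    _ ≤ lam.prod ν A' := by
        refine measure_mono (iUnion_subset fun n => ?_)
        rintro _ ⟨q, hq, rfl⟩
        exact (hsubB n hq).2.2

end Comparison

/-! ### The invariant measure on `X` induced by ν. -/

section InducedMeasure

open Set

theorem measurable_smul_coe {G : Type*} [Group G] [MeasurableSpace G] {X : Type*}
    [MeasurableSpace X] [MulAction G X] {Y : Set X} (hact : Measurable (fun q : G × X => q.1 • q.2)) :
    Measurable (fun q : G × Y => q.1 • (q.2 : X)) :=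
  hact.comp (measurable_fst.prodMk (measurable_subtype_coe.comp measurable_snd))

theorem injOn_smul_coe {G : Type*} [Group G] {X : Type*} [MulAction G X] {Y : Set X} {P : Set G}
    (h : InjOn (fun q : G × X => q.1 • q.2) (P ×ˢ Y)) :
    InjOn (fun q : G × Y => q.1 • (q.2 : X)) (P ×ˢ univ) := by
  rintro ⟨g, y⟩ ⟨hg, -⟩ ⟨g', y'⟩ ⟨hg', -⟩ hgy
  have := h (x₁ := (g, (y : X))) (x₂ := (g', (y' : X))) ⟨hg, y.2⟩ ⟨hg', y'.2⟩ hgy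
  exact Prod.ext (Prod.mk.inj this).1 (Subtype.ext (Prod.mk.inj this).2)

variable {G : Type*} [Group G] [MeasurableSpace G] {X : Type*} [MeasurableSpace X]
  [MulAction G X] {Y : Set X}

/-- The push-forward of `lam|_P × ν` under `(g, y) ↦ g • y`. -/
noncomputable def localMeasure (lam : Measure G) (ν : Measure Y) (P : Set G) : Measure X :=
  ((lam.restrict P).prod ν).map (fun q : G × Y => q.1 • (q.2 : X))

theorem localMeasure_apply (hact : Measurable (fun q : G × X => q.1 • q.2)) (lam : Measure G)
    [SFinite lam] (ν : Measure Y) [SFinite ν] {P : Set G}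
    {B : Set X} (hB : MeasurableSet B) :
    localMeasure lam ν P B =
      lam.prod ν ((fun q : G × Y => q.1 • (q.2 : X)) ⁻¹' B ∩ P ×ˢ univ) := by
  have hq := measurable_smul_coe (Y := Y) hact
  rw [localMeasure, Measure.map_apply hq hB]
  nth_rw 1 [← Measure.restrict_univ (μ := ν)]
  rw [Measure.prod_restrict, Measure.restrict_apply (hq hB)]

/-- Acting by c on g • y is left multiplication by c on the `G`-coordinate, so left invariance of
`lam` suffices. -/
theorem localMeasure_smul [MeasurableMul G] (hact : Measurable (fun q : G × X => q.1 • q.2))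
    (lam : Measure G) [SFinite lam] [lam.IsMulLeftInvariant] (ν : Measure Y) [SFinite ν]
    {P : Set G} (hP : MeasurableSet P) (c : G) {B : Set X} (hB : MeasurableSet B) :
    localMeasure lam ν (c⁻¹ • P) ((fun x => c • x) ⁻¹' B) = localMeasure lam ν P B := by
  have hc : Measurable (fun x : X => c • x) := hact.comp (measurable_const.prodMk measurable_id)
  have hq := measurable_smul_coe (Y := Y) hact
  rw [localMeasure_apply hact lam ν (hc hB), localMeasure_apply hact lam ν hB]
  have hmp : MeasurePreserving (Prod.map (fun g => c * g) id) (lam.prod ν) (lam.prod ν) :=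
    (measurePreserving_mul_left lam c).prod (MeasurePreserving.id ν)
  rw [← hmp.measure_preimage ((hq hB).inter (hP.prod MeasurableSet.univ)).nullMeasurableSet]
  congr 1
  ext ⟨g, y⟩
  simp [mem_smul_set_iff_inv_smul_mem, mul_smul]

variable [TopologicalSpace G] [IsTopologicalGroup G] [T2Space G] [LocallyCompactSpace G]
  [SecondCountableTopology G] [BorelSpace G]

theorem measurableSet_smul_of_injOn [StandardBorelSpace X]
    (hact : Measurable (fun q : G × X => q.1 • q.2)) (hY : MeasurableSet Y) {P : Set G}
    (hP : MeasurableSet P) (h : InjOn (fun q : G × X => q.1 • q.2) (P ×ˢ Y)) :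
    MeasurableSet (P • Y) := by
  have : PolishSpace G := polishSpace_of_locallyCompact_group G
  rw [← image_smul_prod]
  exact (hP.prod hY).image_of_measurable_injOn hact h

/-- The local measures of two sets agree on the common part of their translates of `Y`. -/
theorem localMeasure_eq [StandardBorelSpace X] (hact : Measurable (fun q : G × X => q.1 • q.2))
    (hY : MeasurableSet Y) {U : Set G} (hU : U ∈ 𝓝 (1 : G))
    (hUinj : InjOn (fun q : G × X => q.1 • q.2) (U ×ˢ Y))
    (lam : Measure G) [SFinite lam] [lam.IsMulRightInvariant]
    (ν : Measure Y) [SFinite ν] (hν : IsGraphInvariant (crossSectionRel G Y) ν)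
    {P Q : Set G} (hP : MeasurableSet P) (hQ : MeasurableSet Q)
    (hPinj : InjOn (fun q : G × X => q.1 • q.2) (P ×ˢ Y))
    (hQinj : InjOn (fun q : G × X => q.1 • q.2) (Q ×ˢ Y))
    {B : Set X} (hB : MeasurableSet B) (hBP : B ⊆ P • Y) (hBQ : B ⊆ Q • Y) :
    localMeasure lam ν P B = localMeasure lam ν Q B := by
  have : PolishSpace G := polishSpace_of_locallyCompact_group G
  obtain ⟨W, hW, hWcov, hWinj⟩ := exists_injOn_cover isOpen_interior
    (mem_interior_iff_mem_nhds.2 hU) (hUinj.mono (prod_mono_left interior_subset))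
  have hq := measurable_smul_coe (Y := Y) hact
  have key : ∀ {P Q : Set G}, MeasurableSet P → MeasurableSet Q →
      InjOn (fun q : G × X => q.1 • q.2) (P ×ˢ Y) → B ⊆ Q • Y →
      localMeasure lam ν P B ≤ localMeasure lam ν Q B := by
    intro P Q hP hQ hPi hBQ
    rw [localMeasure_apply hact lam ν hB, localMeasure_apply hact lam ν hB]
    refine prod_measure_le_of_image_subset hact hY hν hW hWcov hWinj
      ((hq hB).inter (hP.prod MeasurableSet.univ)) ((hq hB).inter (hQ.prod MeasurableSet.univ))
      ((injOn_smul_coe hPi).mono inter_subset_right) ?_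
    rintro _ ⟨q, ⟨hqB, -⟩, rfl⟩
    obtain ⟨g, hg, y, hy, hgy⟩ := mem_smul.1 (hBQ hqB)
    exact ⟨(g, ⟨y, hy⟩), ⟨by simpa only [mem_preimage, hgy] using hqB, hg, trivial⟩, hgy⟩
  exact le_antisymm (key hP hQ hPinj hBQ) (key hQ hP hQinj hBP)

/-- A measure invariant under the cross section equivalence relation of a co-compact cross
section is the canonical measure of an invariant probability measure. -/
theorem exists_invariant_measure_of_crossSection [StandardBorelSpace X]
    (hact : Measurable (fun q : G × X => q.1 • q.2))
    (hY : MeasurableSet Y) {U : Set G} (hU : U ∈ 𝓝 (1 : G))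
    (hUinj : InjOn (fun q : G × X => q.1 • q.2) (U ×ˢ Y))
    {K : Set G} (hK : IsCompact K) (hKY : K • Y = univ)
    (lam : Measure G) [lam.IsHaarMeasure] [lam.IsMulRightInvariant]
    (ν : Measure Y) [IsProbabilityMeasure ν] (hν : IsGraphInvariant (crossSectionRel G Y) ν) :
    ∃ μ : Measure X, IsProbabilityMeasure μ ∧ SMulInvariantMeasure G X μ ∧
      IsCanonicalMeasure lam μ Y ν := by
  have : StandardBorelSpace Y := hY.standardBorel
  have hq := measurable_smul_coe (Y := Y) hact
  obtain ⟨C, hC, hC1⟩ := exists_compact_mem_nhds (1 : G)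
  -- Open, so that `lam V` is positive, and inside a compact set, so that it is finite.
  let V := interior U ∩ interior C
  have oV : IsOpen V := isOpen_interior.inter isOpen_interior
  have V1 : (1 : G) ∈ V := ⟨mem_interior_iff_mem_nhds.2 hU, mem_interior_iff_mem_nhds.2 hC1⟩
  have Vfin : lam V < ⊤ :=
    (measure_mono (inter_subset_right.trans interior_subset)).trans_lt hC.measure_lt_top
  have Vpos : 0 < lam V := oV.measure_pos lam ⟨1, V1⟩
  have Vinj : InjOn (fun q : G × X => q.1 • q.2) (V ×ˢ Y) :=
    hUinj.mono (prod_mono_left (inter_subset_left.trans interior_subset))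
  obtain ⟨t, -, ht⟩ := exists_translate_cover (oV.mem_nhds V1)
  have tinj : ∀ i, InjOn (fun q : G × X => q.1 • q.2) ((t i • V) ×ˢ Y) :=
    fun i => injOn_translate_smul Vinj (t i)
  have mt : ∀ i, MeasurableSet (t i • V) := fun i => (oV.smul (t i)).measurableSet
  have mtY : ∀ i, MeasurableSet ((t i • V) • Y) := fun i =>
    measurableSet_smul_of_injOn hact hY (mt i) (tinj i)
  let D : ℕ → Set X := disjointed fun i => (t i • V) • Y
  have mD : ∀ i, MeasurableSet (D i) := MeasurableSet.disjointed mtY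
  have hD : ∀ i, D i ⊆ (t i • V) • Y := fun i => disjointed_subset _ i
  have dD : Pairwise (Function.onFun Disjoint D) := disjoint_disjointed _
  have cD : ⋃ i, D i = univ := by
    rw [iUnion_disjointed]
    refine eq_univ_of_forall fun x => ?_
    obtain ⟨g, -, y, hy, rfl⟩ := mem_smul.1 (hKY ▸ mem_univ x : x ∈ K • Y)
    obtain ⟨i, hi⟩ := ht g
    exact mem_iUnion.2 ⟨i, smul_mem_smul hi hy⟩
  have split : ∀ (m : Measure X) {B : Set X}, MeasurableSet B → m B = ∑' i, m (B ∩ D i) := by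
    intro m B hB
    rw [← measure_iUnion (fun i j hij => (dD hij).mono inter_subset_right inter_subset_right)
      (fun i => hB.inter (mD i)), ← inter_iUnion, cD, inter_univ]
  -- The local measures glued along the disjoint pieces `D i`; by `loc` the result does not depend
  -- on the cover.
  let μ₀ : Measure X := Measure.sum fun i => (localMeasure lam ν (t i • V)).restrict (D i)
  have loc : ∀ {P : Set G}, MeasurableSet P →
      InjOn (fun q : G × X => q.1 • q.2) (P ×ˢ Y) → ∀ {B : Set X}, MeasurableSet B →
      B ⊆ P • Y → μ₀ B = localMeasure lam ν P B := by
    intro P hP hPinj B hB hBP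
    rw [split (localMeasure lam ν P) hB, Measure.sum_apply _ hB]
    refine tsum_congr fun i => ?_
    rw [Measure.restrict_apply hB]
    exact localMeasure_eq hact hY hU hUinj lam ν hν (mt i) hP (tinj i) hPinj (hB.inter (mD i))
      (inter_subset_right.trans (hD i)) (inter_subset_left.trans hBP)
  have inv : ∀ (c : G) {B : Set X}, MeasurableSet B → μ₀ ((fun x => c • x) ⁻¹' B) = μ₀ B := by
    intro c B hB
    have hc : Measurable (fun x : X => c • x) :=
      hact.comp (measurable_const.prodMk measurable_id)
    rw [split μ₀ hB]
    have h1 : (fun x => c • x) ⁻¹' B = ⋃ i, (fun x => c • x) ⁻¹' (B ∩ D i) := by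
      rw [← preimage_iUnion, ← inter_iUnion, cD, inter_univ]
    rw [h1, measure_iUnion (fun i j hij =>
      ((dD hij).mono inter_subset_right inter_subset_right).preimage _)
      (fun i => hc (hB.inter (mD i)))]
    -- The preimage of a subset of `D i` lies in (c⁻¹ t_i V) • Y, where `loc` identifies μ₀ with
    -- another local measure.
    refine tsum_congr fun i => ?_
    rw [loc (mt i) (tinj i) (hB.inter (mD i)) (inter_subset_right.trans (hD i)),
      ← localMeasure_smul hact lam ν (mt i) c (hB.inter (mD i))]
    refine loc ((mt i).const_smul c⁻¹) (injOn_translate_smul (tinj i) c⁻¹)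
      (hc (hB.inter (mD i))) ?_
    rintro x ⟨-, hx⟩
    obtain ⟨g, hg, y, hy, hgy⟩ := mem_smul.1 (hD i hx)
    refine mem_smul.2 ⟨c⁻¹ • g, smul_mem_smul_set hg, y, hy, ?_⟩
    rw [smul_assoc, hgy, inv_smul_smul]
  have hle : ∀ i, μ₀ ((t i • V) • Y) = lam V := by
    intro i
    rw [loc (mt i) (tinj i) (mtY i) subset_rfl, localMeasure_apply hact lam ν (mtY i),
      inter_eq_right.2, Measure.prod_prod, measure_univ, mul_one, measure_smul]
    rintro ⟨g, y⟩ ⟨hg, -⟩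
    exact smul_mem_smul hg y.2
  -- Co-compactness is used here: finitely many translates of V cover `K`, and each contributes mass
  -- at most `lam V`.
  have μfin : μ₀ univ ≠ ⊤ := by
    obtain ⟨F, hF⟩ := hK.elim_finite_subcover (fun i => t i • V) (fun i => oV.smul (t i))
      (fun g _ => mem_iUnion.2 (ht g))
    refine ne_top_of_le_ne_top ?_ (measure_mono (t := ⋃ i ∈ F, (t i • V) • Y) ?_)
    · refine ne_top_of_le_ne_top ?_ (measure_biUnion_finset_le F _)
      simp_rw [hle]
      exact ENNReal.sum_ne_top.2 fun i _ => Vfin.ne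
    · intro x _
      obtain ⟨g, hg, y, hy, rfl⟩ := mem_smul.1 (hKY ▸ mem_univ x : x ∈ K • Y)
      obtain ⟨i, hi, hgi⟩ := mem_iUnion₂.1 (hF hg)
      exact mem_iUnion₂.2 ⟨i, hi, smul_mem_smul hgi hy⟩
  have μpos : μ₀ univ ≠ 0 := by
    refine (Vpos.trans_le ?_).ne'
    rw [← hle 0]
    exact measure_mono (subset_univ _)
  have hc : ((μ₀ univ).toNNReal : ENNReal) = μ₀ univ := ENNReal.coe_toNNReal μfin
  -- Normalising μ₀ turns its total mass into the constant of the canonical measure.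
  refine ⟨(μ₀ univ)⁻¹ • μ₀, ⟨?_⟩, ⟨?_⟩, inferInstance, hν.isInvariantMeasure,
    (μ₀ univ).toNNReal, ENNReal.toNNReal_pos μpos μfin, ?_⟩
  · rw [Measure.smul_apply, smul_eq_mul, ENNReal.inv_mul_cancel μpos μfin]
  · intro c B hB
    rw [Measure.smul_apply, Measure.smul_apply, inv c hB]
  · intro P _ hP hPinj
    have mPY := measurableSet_smul_of_injOn hact hY hP hPinj
    have h1 : (μ₀ univ).toNNReal • ((μ₀ univ)⁻¹ • μ₀).restrict (P • Y) = μ₀.restrict (P • Y) := by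
      rw [Measure.restrict_smul, ENNReal.smul_def, hc, smul_smul,
        ENNReal.mul_inv_cancel μpos μfin, one_smul]
    rw [h1]
    ext B hB
    rw [Measure.restrict_apply hB, loc hP hPinj (hB.inter mPY) inter_subset_right]
    change localMeasure lam ν P B = _
    rw [localMeasure_apply hact lam ν hB, localMeasure_apply hact lam ν (hB.inter mPY)]
    congr 1
    ext ⟨g, y⟩
    constructor
    · rintro ⟨h, hg, -⟩
      exact ⟨⟨h, smul_mem_smul hg y.2⟩, hg, trivial⟩
    · rintro ⟨⟨h, -⟩, hg, -⟩
      exact ⟨h, hg, trivial⟩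

end InducedMeasure

/-! ### From almost everywhere to everywhere. -/

section Reduction

open Set

/-- A property of points of `X` that descends along the action and holds `μ`-almost everywhere
holds `ν`-almost everywhere on the cross section. -/
theorem IsCanonicalMeasure.ae_of_ae {G : Type*} [Group G] [TopologicalSpace G]
    [IsTopologicalGroup G] [MeasurableSpace G] [BorelSpace G]
    {lam : Measure G} [lam.IsHaarMeasure] [SFinite lam]
    {X : Type*} [MeasurableSpace X] [MulAction G X] {μ : Measure X} {Y : Set X} {ν : Measure Y}
    (hν : IsCanonicalMeasure lam μ Y ν)
    (hact : Measurable (fun q : G × X => q.1 • q.2)) (hY : IsCrossSection G μ Y)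
    {P : X → Prop} (hP : ∀ g : G, ∀ x, P (g • x) → P x) (hμ : ∀ᵐ x ∂μ, P x) :
    ∀ᵐ y : Y ∂ν, P (y : X) := by
  obtain ⟨U, hU, hinj⟩ := hY.exists_injOn
  have := hν.isProbabilityMeasure
  have hq := measurable_smul_coe (Y := Y) hact
  obtain ⟨c, -, hc⟩ := hν.exists_const
  have h1 := hc (interior U) (interior_mem_nhds.2 hU) isOpen_interior.measurableSet
    (hinj.mono (prod_mono_left interior_subset))
  obtain ⟨N, hN, mN, N0⟩ := exists_measurable_superset_of_null (ae_iff.1 hμ)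
  have h2 : (c • μ.restrict (interior U • Y)) N = 0 := by
    rw [Measure.smul_apply, Measure.restrict_apply mN, measure_mono_null inter_subset_left N0,
      smul_zero]
  rw [← h1, Measure.map_apply hq mN] at h2
  have h3 : ∀ᵐ q ∂(lam.restrict (interior U)).prod ν, q.1 • (q.2 : X) ∉ N := by
    rw [ae_iff]
    simp only [not_not]
    exact h2
  have h4 := Measure.ae_ae_of_ae_prod h3
  have hne : lam.restrict (interior U) ≠ 0 := by
    rw [Ne, Measure.restrict_eq_zero]
    exact (isOpen_interior.measure_pos lam ⟨1, mem_interior_iff_mem_nhds.2 hU⟩).ne'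
  have : Filter.NeBot (ae (lam.restrict (interior U))) := ae_neBot.2 hne
  -- By Fubini a single g works for ν-almost every y; the property then descends from g • y to y.
  obtain ⟨g, hg⟩ := h4.exists
  filter_upwards [hg] with y hy
  refine hP g _ ?_
  by_contra h
  exact hy (hN h)

/-- A conull property of points of `Z` holds on an invariant conull Borel set, for an equivalence
relation that is locally given by a cross section equivalence relation. -/
theorem exists_invariant_conull_set {G : Type*} [Group G] [MeasurableSpace G]
    [StandardBorelSpace G] {X : Type*} [MeasurableSpace X] [StandardBorelSpace X] [MulAction G X]
    (hact : Measurable (fun q : G × X => q.1 • q.2)) {Y : Set X}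
    {W : ℕ → Set G} (hW : ∀ n, MeasurableSet (W n)) (hWcov : ∀ g, ∃ n, g ∈ W n)
    (hWinj : ∀ n, ∀ w ∈ W n, ∀ w' ∈ W n, ∀ y ∈ Y, ∀ y' ∈ Y,
        (w • y = w' • y' → w = w' ∧ y = y') ∧ (w⁻¹ • y = w'⁻¹ • y' → w = w' ∧ y = y'))
    {Z : Type*} [MeasurableSpace Z] [StandardBorelSpace Z] {s : Setoid Z} {ζ : Measure Z}
    (hs : MeasurableSet {q : Z × Z | s q.1 q.2}) (hζ : IsGraphInvariant s ζ)
    {f : Z → X} (hf : Measurable f) (hfY : ∀ z, f z ∈ Y)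
    {P : Z → Prop} (hP : ∀ᵐ z ∂ζ, P z)
    (hrel : ∀ z, P z → ∀ z', s z z' → ∃ g : G, g • f z = f z')
    (hinj : ∀ z, P z → InjOn f {z' | s z z'}) :
    ∃ Z₀ : Set Z, MeasurableSet Z₀ ∧ ζ Z₀ᶜ = 0 ∧ (∀ z ∈ Z₀, P z) ∧
      ∀ z ∈ Z₀, ∀ z', s z z' → z' ∈ Z₀ := by
  obtain ⟨N, hN, mN, N0⟩ := exists_measurable_superset_of_null (ae_iff.1 hP)
  have hPN : ∀ z, z ∉ N → P z := fun z hz => by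
    by_contra h
    exact hz (hN h)
  -- Pairs of a good point and an equivalent bad one, joined by an element of `W n`. Forgetting that
  -- element leaves a partial injection `F n`, because `f` is injective on the class of the good
  -- point.
  let S : ℕ → Set ((Z × Z) × G) := fun n =>
    {q | q.2 ∈ W n ∧ q.2 • f q.1.1 = f q.1.2 ∧ s q.1.1 q.1.2 ∧ q.1.1 ∉ N ∧ q.1.2 ∈ N}
  have mS : ∀ n, MeasurableSet (S n) := by
    intro n
    refine (measurable_snd (hW n)).inter (MeasurableSet.inter ?_ ((measurable_fst hs).inter ?_))
    · exact measurableSet_eq_fun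
        (hact.comp (measurable_snd.prodMk (hf.comp (measurable_fst.comp measurable_fst))))
        (hf.comp (measurable_snd.comp measurable_fst))
    · exact ((measurable_fst.comp measurable_fst) mN).compl.inter
        ((measurable_snd.comp measurable_fst) mN)
  let F : ℕ → Set (Z × Z) := fun n => Prod.fst '' S n
  have mF : ∀ n, MeasurableSet (F n) := by
    intro n
    refine (mS n).image_of_measurable_injOn measurable_fst ?_
    rintro ⟨q, w⟩ ⟨hw, hwq, -⟩ ⟨q', w'⟩ ⟨hw', hwq', -⟩ (rfl : q = q')
    simp only at hw hwq hw' hwq'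
    have := ((hWinj n w hw w' hw' _ (hfY q.2) _ (hfY q.2)).2 (by
      rw [inv_smul_eq_iff.2 hwq.symm, inv_smul_eq_iff.2 hwq'.symm])).1
    rw [this]
  have i1 : ∀ n, InjOn Prod.fst (F n) := by
    rintro n _ ⟨⟨⟨z, z'⟩, w⟩, ⟨hw, hwz, hz, hzN, -⟩, rfl⟩ _
      ⟨⟨⟨v, z''⟩, w'⟩, ⟨hw', hwz', hz', -⟩, rfl⟩ (rfl : z = v)
    simp only at hw hwz hw' hwz' hz hz' hzN
    have h1 : f z' = f z'' := ((hWinj n w hw w' hw' _ (hfY z') _ (hfY z'')).2 (by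
      rw [inv_smul_eq_iff.2 hwz.symm, inv_smul_eq_iff.2 hwz'.symm])).2
    rw [hinj z (hPN z hzN) hz hz' h1]
  have i2 : ∀ n, InjOn Prod.snd (F n) := by
    rintro n _ ⟨⟨⟨z, z'⟩, w⟩, ⟨hw, hwz, hz, hzN, -⟩, rfl⟩ _
      ⟨⟨⟨v, z''⟩, w'⟩, ⟨hw', hwz', hz', -⟩, rfl⟩ (rfl : z' = z'')
    simp only at hw hwz hw' hwz' hz hz' hzN
    have h1 : f z = f v :=
      ((hWinj n w hw w' hw' _ (hfY z) _ (hfY v)).1 (hwz.trans hwz'.symm)).2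
    rw [hinj z (hPN z hzN) (s.refl z) (s.trans hz (s.symm hz')) h1]
  -- The domain has the measure of the range, which lies in the null set `N`. Removing `N` and all
  -- these domains leaves the points whose whole class avoids `N`.
  have F0 : ∀ n, ζ (Prod.fst '' F n) = 0 := by
    intro n
    rw [hζ (F n) (mF n) (by rintro _ ⟨q, hq, rfl⟩; exact hq.2.2.1) (i1 n) (i2 n)]
    refine measure_mono_null ?_ N0
    rintro _ ⟨_, ⟨q, hq, rfl⟩, rfl⟩
    exact hq.2.2.2.2
  have hsat : ∀ z, z ∉ N → (∀ n, z ∉ Prod.fst '' F n) → ∀ z', s z z' → z' ∉ N := by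
    intro z hz hzF z' hzz hz'
    obtain ⟨g, hg⟩ := hrel z (hPN z hz) z' hzz
    obtain ⟨n, hn⟩ := hWcov g
    exact hzF n ⟨(z, z'), ⟨((z, z'), g), ⟨hn, hg, hzz, hz, hz'⟩, rfl⟩, rfl⟩
  refine ⟨(N ∪ ⋃ n, Prod.fst '' F n)ᶜ, ?_, ?_, ?_, ?_⟩
  · exact (mN.union (MeasurableSet.iUnion fun n =>
      (mF n).image_of_measurable_injOn measurable_fst (i1 n))).compl
  · rw [compl_compl]
    exact measure_union_null N0 (measure_iUnion_null F0)
  · intro z hz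
    exact hPN z fun h => hz (Or.inl h)
  · rintro z hz z' hzz (h | h)
    · exact hsat z (fun h => hz (Or.inl h)) (fun n h => hz (Or.inr (mem_iUnion.2 ⟨n, h⟩))) z' hzz h
    · obtain ⟨n, _, ⟨⟨⟨v, z''⟩, w⟩, ⟨-, -, hz'', -, hN''⟩, rfl⟩, (rfl : v = z')⟩ := mem_iUnion.1 h
      exact hsat z (fun h => hz (Or.inl h)) (fun n h => hz (Or.inr (mem_iUnion.2 ⟨n, h⟩))) z''
        (s.trans hzz hz'') hN''

end Reduction

/-! ### The selector and the lifted action. -/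

section Construction

open Set

variable {G : Type u} [Group G] [TopologicalSpace G] [IsTopologicalGroup G] [T2Space G]
  [LocallyCompactSpace G] [SecondCountableTopology G] [MeasurableSpace G] [BorelSpace G]
  {X : Type v} [MeasurableSpace X] [StandardBorelSpace X] [MulAction G X]

/-- A Borel selector `x ↦ y` from the saturation of a cross section `Y` to `Y` along orbits that is
the identity on `Y`, given by its graph. -/
theorem exists_borel_selector (hact : Measurable (fun q : G × X => q.1 • q.2)) {Y : Set X}
    (hY : MeasurableSet Y) {U : Set G} (hU : U ∈ 𝓝 (1 : G))
    (hinj : InjOn (fun q : G × X => q.1 • q.2) (U ×ˢ Y)) :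
    ∃ R : Set (X × X), MeasurableSet R ∧ (∀ x y, (x, y) ∈ R → y ∈ Y ∧ ∃ g : G, g • y = x) ∧
      (∀ g : G, ∀ y ∈ Y, ∃ y', (g • y, y') ∈ R) ∧
      (∀ x y y', (x, y) ∈ R → (x, y') ∈ R → y = y') ∧ ∀ y ∈ Y, (y, y) ∈ R := by
  have : PolishSpace G := polishSpace_of_locallyCompact_group G
  have oV : IsOpen (interior U) := isOpen_interior
  have V1 : (1 : G) ∈ interior U := mem_interior_iff_mem_nhds.2 hU
  have Vinj : InjOn (fun q : G × X => q.1 • q.2) (interior U ×ˢ Y) :=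
    hinj.mono (prod_mono_left interior_subset)
  set V := interior U
  obtain ⟨t, t0, ht⟩ := exists_translate_cover (oV.mem_nhds V1)
  have tinj : ∀ i, InjOn (fun q : G × X => q.1 • q.2) ((t i • V) ×ˢ Y) :=
    fun i => injOn_translate_smul Vinj (t i)
  have mt : ∀ i, MeasurableSet (t i • V) := fun i => (oV.smul (t i)).measurableSet
  have mtY : ∀ i, MeasurableSet ((t i • V) • Y) := fun i =>
    measurableSet_smul_of_injOn hact hY (mt i) (tinj i)
  let D : ℕ → Set X := disjointed fun i => (t i • V) • Y
  have mD : ∀ i, MeasurableSet (D i) := MeasurableSet.disjointed mtY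
  have dD : Pairwise (Function.onFun Disjoint D) := disjoint_disjointed _
  -- Above `D i` a point is written uniquely as g • y with g in `t i • V`; the selector returns that
  -- y.
  let S : ℕ → Set (G × X) := fun i => ((t i • V) ×ˢ Y) ∩ (fun q : G × X => q.1 • q.2) ⁻¹' D i
  have mem : ∀ {i} {g : G} {y : X}, g ∈ t i • V → y ∈ Y → g • y ∈ D i →
      (g • y, y) ∈ ⋃ i, (fun q : G × X => (q.1 • q.2, q.2)) '' S i := fun {i g y} hg hy hgy =>
    mem_iUnion.2 ⟨i, (g, y), ⟨⟨hg, hy⟩, hgy⟩, rfl⟩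
  refine ⟨⋃ i, (fun q : G × X => (q.1 • q.2, q.2)) '' S i, ?_, ?_, ?_, ?_, ?_⟩
  · refine MeasurableSet.iUnion fun i => ?_
    refine (((mt i).prod hY).inter (hact (mD i))).image_of_measurable_injOn
      (hact.prodMk measurable_snd) ?_
    intro q hq q' hq' h
    exact tinj i hq.1 hq'.1 (Prod.mk.inj h).1
  · intro x y h
    obtain ⟨i, q, hq, hqq⟩ := mem_iUnion.1 h
    obtain ⟨h1, h2⟩ := Prod.mk.inj hqq
    subst h1 h2
    exact ⟨hq.1.2, q.1, rfl⟩
  · intro g y hy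
    obtain ⟨i, hi⟩ := ht g
    have : g • y ∈ ⋃ i, D i := by
      rw [iUnion_disjointed]
      exact mem_iUnion.2 ⟨i, smul_mem_smul hi hy⟩
    obtain ⟨j, hj⟩ := mem_iUnion.1 this
    obtain ⟨h, hh, y', hy', hhy⟩ := mem_smul.1 (disjointed_subset _ j hj)
    rw [← hhy] at hj ⊢
    exact ⟨y', mem hh hy' hj⟩
  · intro x y y' h h'
    obtain ⟨i, q, hq, hqq⟩ := mem_iUnion.1 h
    obtain ⟨j, q', hq', hqq'⟩ := mem_iUnion.1 h'
    obtain ⟨h1, h2⟩ := Prod.mk.inj hqq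
    obtain ⟨h1', h2'⟩ := Prod.mk.inj hqq'
    have hij : i = j := by
      by_contra hij
      refine Set.disjoint_left.1 (dD hij) hq.2 ?_
      have h4 : q.1 • q.2 = q'.1 • q'.2 := h1.trans h1'.symm
      have h5 : q'.1 • q'.2 ∈ D j := hq'.2
      rwa [← h4] at h5
    subst hij
    rw [← h2, ← h2', tinj i hq.1 hq'.1 (h1.trans h1'.symm)]
  · intro y hy
    -- Since `t 0 = 1`, all of `Y` lies in the first piece `D 0`, where y is written as 1 • y.
    have h0 : (1 : G) ∈ t 0 • V := by rw [t0, one_smul]; exact V1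
    have : (1 : G) • y ∈ D 0 := by
      simp only [D, disjointed_zero]
      exact smul_mem_smul h0 hy
    simpa only [one_smul] using mem h0 hy this

/-- The action obtained by lifting an action with a cross section along a class-bijective map. -/
theorem exists_lifted_action (hact : Measurable (fun q : G × X => q.1 • q.2)) {Y : Set X}
    (hY : MeasurableSet Y) {U : Set G} (hU : U ∈ 𝓝 (1 : G))
    (hinj : InjOn (fun q : G × X => q.1 • q.2) (U ×ˢ Y))
    {K : Set G} (hK : ∀ g : G, g • (K • Y) = K • Y)
    {Z : Type w} [MeasurableSpace Z] [StandardBorelSpace Z] {s : Setoid Z}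
    (hs : MeasurableSet {q : Z × Z | s q.1 q.2}) {f : Z → X} (hf : Measurable f)
    (hfY : ∀ z, f z ∈ Y) (h1 : ∀ z z', s z z' → ∃ g : G, g • f z = f z')
    (h2 : ∀ z, ∀ g : G, g • f z ∈ Y → ∃ z', s z z' ∧ f z' = g • f z)
    (h3 : ∀ z z', s z z' → f z = f z' → z = z')
    (hfK : ∀ z, f z ∈ K • Y) (hfree : ∀ z, MulAction.stabilizer G (f z) = ⊥) :
    ∃ (X' : Type (max v w)) (_ : MeasurableSpace X') (_ : StandardBorelSpace X')
      (_ : MulAction G X') (ι : Z → X'),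
      Measurable (fun q : G × X' => q.1 • q.2) ∧ MeasurableEmbedding ι ∧
      InjOn (fun q : G × X' => q.1 • q.2) (U ×ˢ range ι) ∧ K • range ι = univ ∧
      (∀ z z', s z z' ↔ ∃ g : G, g • ι z = ι z') ∧
      ∀ x : X', MulAction.stabilizer G x = ⊥ := by
  have : PolishSpace G := polishSpace_of_locallyCompact_group G
  obtain ⟨R, mR, hR, Rex, Runiq, Rid⟩ := exists_borel_selector hact hY hU hinj
  -- The fibre product of `X` and `Z` over `Y`. A point is determined by its first coordinate and
  -- the class of its second (`uniq`), so the action laws reduce to those on `X`.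
  let S : Set (X × Z) := {q | (q.1, f q.2) ∈ R}
  have mS : MeasurableSet S := (measurable_fst.prodMk (hf.comp measurable_snd)) mR
  have hSb : StandardBorelSpace S := mS.standardBorel
  have lift : ∀ (g : G) (z : Z), ∃ b : S, b.1.1 = g • f z ∧ s z b.1.2 := by
    intro g z
    obtain ⟨y', hy'⟩ := Rex g (f z) (hfY z)
    obtain ⟨hyY, k, hk⟩ := hR _ _ hy'
    have hky : (k⁻¹ * g) • f z = y' := by rw [mul_smul, ← hk, inv_smul_smul]
    obtain ⟨z', hz, hz'⟩ := h2 z (k⁻¹ * g) (by rw [hky]; exact hyY)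
    rw [hky] at hz'
    subst hz'
    exact ⟨⟨(g • f z, z'), hy'⟩, rfl, hz⟩
  have uniq : ∀ b c : S, b.1.1 = c.1.1 → s b.1.2 c.1.2 → b = c := by
    rintro ⟨⟨x, z⟩, hb⟩ ⟨⟨x', z'⟩, hc⟩ (rfl : x = x') hz
    have := h3 z z' hz (Runiq _ _ _ hb hc)
    subst this
    rfl
  have rep : ∀ a : S, ∃ h : G, h • f a.1.2 = a.1.1 := fun a => (hR _ _ a.2).2
  have ex : ∀ (g : G) (a : S), ∃ b : S, b.1.1 = g • a.1.1 ∧ s a.1.2 b.1.2 := by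
    intro g a
    obtain ⟨h, hh⟩ := rep a
    obtain ⟨b, hb, hb'⟩ := lift (g * h) a.1.2
    exact ⟨b, by rw [hb, mul_smul, hh], hb'⟩
  choose act act1 act2 using ex
  have act_eq : ∀ {g : G} {a b : S}, b.1.1 = g • a.1.1 → s a.1.2 b.1.2 → act g a = b :=
    fun {g a b} hb hb' =>
      uniq _ _ ((act1 g a).trans hb.symm) (s.trans (s.symm (act2 g a)) hb')
  let A : MulAction G S :=
    { smul := act
      one_smul := fun a => act_eq (one_smul G _).symm (s.refl _)
      mul_smul := fun g h a => act_eq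
        (by
          change (act g (act h a)).1.1 = _
          rw [act1, act1, mul_smul])
        (s.trans (act2 h a) (act2 g _)) }
  have smul_def : ∀ (g : G) (a : S), g • a = act g a := fun _ _ => rfl
  let ι : Z → S := fun z => ⟨(f z, z), Rid _ (hfY z)⟩
  have mι : Measurable ι := (hf.prodMk measurable_id).subtype_mk
  have iι : Function.Injective ι := fun z z' h =>
    (Prod.mk.inj (congrArg Subtype.val h)).2
  refine ⟨S, inferInstance, hSb, A, ι, ?_, mι.measurableEmbedding iι, ?_, ?_, ?_, ?_⟩
  -- Although `act` is obtained by choice, uniqueness describes its graph by two Borel conditions.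
  · refine measurable_of_measurableSet_graph ?_
    have : {q : (G × S) × S | q.2 = q.1.1 • q.1.2} =
        {q : (G × S) × S | q.2.1.1 = q.1.1 • q.1.2.1.1} ∩
          {q : (G × S) × S | s q.1.2.1.2 q.2.1.2} := by
      ext ⟨⟨g, a⟩, b⟩
      constructor
      · rintro (rfl : b = act g a)
        exact ⟨act1 g a, act2 g a⟩
      · rintro ⟨hb, hb'⟩
        exact (act_eq hb hb').symm
    rw [this]
    have hact₁ : Measurable (fun q : (G × S) × S => q.1.1 • q.1.2.1.1) :=
      hact.comp (show Measurable (fun q : (G × S) × S => (q.1.1, q.1.2.1.1)) by fun_prop)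
    refine MeasurableSet.inter (measurableSet_eq_fun ?_ hact₁) ?_
    · fun_prop
    · have hm : Measurable (fun q : (G × S) × S => (q.1.2.1.2, q.2.1.2)) := by fun_prop
      exact hm hs
  · rintro ⟨g, _⟩ ⟨hg, z, rfl⟩ ⟨g', _⟩ ⟨hg', z', rfl⟩ (h : act g (ι z) = act g' (ι z'))
    have h4 : g • f z = g' • f z' := by
      rw [← act1 g (ι z), ← act1 g' (ι z'), h]
    obtain ⟨h5, h6⟩ := Prod.mk.inj (hinj (x₁ := (g, f z)) (x₂ := (g', f z')) ⟨hg, hfY z⟩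
      ⟨hg', hfY z'⟩ h4)
    have h7 : s z z' := by
      have := act2 g (ι z)
      rw [h] at this
      exact s.trans this (s.symm (act2 g' (ι z')))
    rw [h5, h3 z z' h7 h6]
  -- Write the first coordinate as k • y with k in `K` and y in `Y`; the point over y in the class
  -- of the second coordinate gives the element of `range ι` that k moves to a.
  · refine eq_univ_of_forall fun a => ?_
    obtain ⟨h, hh⟩ := rep a
    have ha : a.1.1 ∈ K • Y := by
      rw [← hh, ← hK h]
      exact smul_mem_smul_set (hfK _)
    obtain ⟨k, hk, y, hy, hky⟩ := mem_smul.1 ha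
    have hky' : (k⁻¹ * h) • f a.1.2 = y := by rw [mul_smul, hh, ← hky, inv_smul_smul]
    obtain ⟨z', hz, hz'⟩ := h2 a.1.2 (k⁻¹ * h) (by rw [hky']; exact hy)
    refine mem_smul.2 ⟨k, hk, ι z', ⟨z', rfl⟩, act_eq ?_ (s.symm hz)⟩
    change a.1.1 = k • f z'
    rw [hz', hky', hky]
  · intro z z'
    constructor
    · intro h
      obtain ⟨g, hg⟩ := h1 z z' h
      exact ⟨g, act_eq hg.symm h⟩
    · rintro ⟨g, hg⟩
      have := act2 g (ι z)
      rwa [← smul_def, hg] at this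
  · intro a
    rw [eq_bot_iff]
    intro g hg
    rw [MulAction.mem_stabilizer_iff] at hg
    obtain ⟨h, hh⟩ := rep a
    have hx : g • a.1.1 = a.1.1 := by
      rw [← act1 g a, ← smul_def, hg]
    have hmem : h⁻¹ * g * h ∈ MulAction.stabilizer G (f a.1.2) := by
      rw [MulAction.mem_stabilizer_iff, mul_smul, mul_smul, hh, hx, ← hh, inv_smul_smul]
    rw [hfree, Subgroup.mem_bot] at hmem
    rw [Subgroup.mem_bot]
    have : g = h * (h⁻¹ * g * h) * h⁻¹ := by group
    rw [this, hmem, mul_one, mul_inv_cancel]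

end Construction

/-! ### Assembling the action, the measure and the isomorphism. -/

theorem mainTheorem9
    {G : Type u} [Group G] [TopologicalSpace G] [IsTopologicalGroup G] [T2Space G]
    [LocallyCompactSpace G] [SecondCountableTopology G] [MeasurableSpace G] [BorelSpace G]
    -- `G` is unimodular: its Haar measure is left and right invariant
    (lam : Measure G) [lam.IsHaarMeasure] [lam.IsMulRightInvariant]
    {X : Type v} [MeasurableSpace X] [StandardBorelSpace X] [MulAction G X]
    (μ : Measure X) (hμ : IsFreePMPAction G μ)
    (Y : Set X) (hY : IsCocompactCrossSection G μ Y)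
    (ν : Measure Y) (hν : IsCanonicalMeasure lam μ Y ν)
    {Z : Type w} [MeasurableSpace Z] [StandardBorelSpace Z]
    (ζ : Measure Z) (s : Setoid Z) (hs : IsCountablePMPRel s ζ)
    (hext : IsClassBijectiveExtension s ζ (crossSectionRel G Y) ν) :
    ∃ (X' : Type (max v w)) (_ : MeasurableSpace X') (_ : StandardBorelSpace X')
      (_ : MulAction G X') (μ' : Measure X') (Y' : Set X') (ν' : Measure Y'),
      IsFreePMPAction G μ' ∧
      IsCocompactCrossSection G μ' Y' ∧
      IsCanonicalMeasure lam μ' Y' ν' ∧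
      AreIsomorphicRel (crossSectionRel G Y') ν' s ζ := by
  have : PolishSpace G := polishSpace_of_locallyCompact_group G
  have := hs.isProbabilityMeasure
  have hact := hμ.measurable_smul
  obtain ⟨U, hU, hinj⟩ := hY.exists_injOn
  obtain ⟨K, hK, -, hKinv, hK0⟩ := hY.exists_compact
  obtain ⟨p, hp, hp1, hp2⟩ := hext
  have hfree : ∀ᵐ y : Y ∂ν, MulAction.stabilizer G (y : X) = ⊥ :=
    hν.ae_of_ae hact hY.toIsCrossSection (P := fun x => MulAction.stabilizer G x = ⊥) (by
      intro g x hx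
      rw [MulAction.stabilizer_smul_eq_stabilizer_map_conj] at hx
      exact (Subgroup.map_eq_bot_iff_of_injective _ (MulAut.conj g).injective).1 hx)
      hμ.essentially_free
  have hKY : ∀ᵐ y : Y ∂ν, (y : X) ∈ K • Y :=
    hν.ae_of_ae hact hY.toIsCrossSection (P := fun x => x ∈ K • Y) (by
      intro g x hx
      rwa [← hKinv g, Set.smul_mem_smul_set_iff] at hx)
      (by rw [ae_iff]; exact hK0)
  have hgood : ∀ᵐ z ∂ζ, (Set.InjOn p {z' | s z z'} ∧
      p '' {z' | s z z'} = {y | crossSectionRel G Y (p z) y}) ∧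
      MulAction.stabilizer G (p z : X) = ⊥ ∧ (p z : X) ∈ K • Y :=
    (hp1.and hp2).and (hp.quasiMeasurePreserving.ae (hfree.and hKY))
  obtain ⟨W, hW, hWcov, hWinj⟩ := exists_injOn_cover isOpen_interior
    (mem_interior_iff_mem_nhds.2 hU) (hinj.mono (Set.prod_mono_left interior_subset))
  have hf : Measurable (fun z => (p z : X)) := measurable_subtype_coe.comp hp.measurable
  have hrel : ∀ z, p '' {z' | s z z'} = {y | crossSectionRel G Y (p z) y} →
      ∀ z', s z z' → ∃ g : G, g • (p z : X) = p z' := by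
    intro z hz z' hzz
    have : p z' ∈ {y | crossSectionRel G Y (p z) y} := hz ▸ ⟨z', hzz, rfl⟩
    exact (crossSectionRel G Y).symm this
  -- Invariance of `Z₀` keeps its classes whole, so p still maps them onto the classes of `Y`.
  obtain ⟨Z₀, mZ₀, hZ₀, hgood₀, hinv₀⟩ := exists_invariant_conull_set hact hW hWcov hWinj
    hs.measurableSet hs.invariant.isGraphInvariant hf (fun z => (p z).2) hgood
    (fun z hz => hrel z hz.1.2)
    (fun z hz z₁ h₁ z₂ h₂ h => hz.1.1 h₁ h₂ (Subtype.ext h))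
  have : StandardBorelSpace Z₀ := mZ₀.standardBorel
  obtain ⟨X', _, _, _, ι, hact', hι, hinj', hK', hrel', hfree'⟩ :=
    exists_lifted_action hact hY.measurableSet hU hinj hKinv (Z := Z₀)
      (s := s.comap Subtype.val) (f := fun z => (p z.1 : X))
      ((show Measurable (fun q : Z₀ × Z₀ => (q.1.1, q.2.1)) by fun_prop) hs.measurableSet)
      (hf.comp measurable_subtype_coe) (fun z => (p z.1).2)
      (fun z z' h => hrel z.1 (hgood₀ z.1 z.2).1.2 z'.1 h)
      (by
        intro z g hg
        have h1 : (⟨g • (p z.1 : X), hg⟩ : Y) ∈ p '' {z' | s z z'} := by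
          rw [(hgood₀ z.1 z.2).1.2]
          exact (crossSectionRel G Y).symm ⟨g, rfl⟩
        obtain ⟨z', hz', hpz⟩ := h1
        exact ⟨⟨z', hinv₀ z.1 z.2 z' hz'⟩, hz', congrArg Subtype.val hpz⟩)
      (fun z z' h h' => Subtype.ext
        ((hgood₀ z.1 z.2).1.1 (s.refl _) h (Subtype.ext h')))
      (fun z => (hgood₀ z.1 z.2).2.2) (fun z => (hgood₀ z.1 z.2).2.1)
  let e : Z₀ ≃ᵐ Set.range ι := hι.equivRange
  have he : ∀ z, (e z : X') = ι z := fun z => by simp [e]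
  have hj : MeasurableEmbedding (fun y => (e.symm y : Z)) :=
    (MeasurableEmbedding.subtype_coe mZ₀).comp e.symm.measurableEmbedding
  have hjrel : ∀ a b : Set.range ι, crossSectionRel G (Set.range ι) a b ↔
      s (e.symm a : Z) (e.symm b : Z) := by
    intro a b
    obtain ⟨a, rfl⟩ := e.surjective a
    obtain ⟨b, rfl⟩ := e.surjective b
    rw [e.symm_apply_apply, e.symm_apply_apply]
    refine Iff.trans ⟨fun h => ?_, fun h => ?_⟩ (hrel' a b).symm
    · obtain ⟨g, hg⟩ := (crossSectionRel G (Set.range ι)).symm h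
      exact ⟨g, by simpa only [he] using hg⟩
    · obtain ⟨g, hg⟩ := h
      exact (crossSectionRel G (Set.range ι)).symm ⟨g, by simpa only [he] using hg⟩
  -- The restriction of ζ to `Z₀`, carried to the new cross section; the isomorphism with `s` is
  -- then `e.symm`.
  let ν' : Measure (Set.range ι) := ζ.comap (fun y => (e.symm y : Z))
  have hν'inv : IsGraphInvariant (crossSectionRel G (Set.range ι)) ν' :=
    hs.invariant.isGraphInvariant.comap hj fun a b => (hjrel a b).1
  have hν'prob : IsProbabilityMeasure ν' := by
    refine ⟨?_⟩
    have hrange : (fun y => (e.symm y : Z)) '' Set.univ = Z₀ := by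
      rw [Set.image_univ]
      ext z
      constructor
      · rintro ⟨y, rfl⟩
        exact (e.symm y).2
      · intro hz
        exact ⟨e ⟨z, hz⟩, by simp⟩
    rw [hj.comap_apply, hrange]
    exact (prob_compl_eq_zero_iff mZ₀).1 hZ₀
  obtain ⟨μ', hμ'prob, hμ'inv, hcan⟩ := exists_invariant_measure_of_crossSection hact'
    hι.measurableSet_range hU hinj' hK hK' lam ν' hν'inv
  refine ⟨X', inferInstance, inferInstance, inferInstance, μ', Set.range ι, ν',
    ⟨hact', hμ'prob, hμ'inv, Filter.Eventually.of_forall hfree'⟩,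
    ⟨⟨hι.measurableSet_range, ⟨U, hU, hinj'⟩, ?_⟩, K, hK, ?_, ?_, ?_⟩, hcan, ?_⟩
  · have : (Set.univ : Set G) • Set.range ι = Set.univ :=
      Set.univ_subset_iff.1 (hK' ▸ Set.smul_subset_smul_right (Set.subset_univ K))
    rw [this, Set.compl_univ, measure_empty]
  · rw [hK']
    exact MeasurableSet.univ
  · intro g
    rw [hK', Set.smul_set_univ]
  · rw [hK', Set.compl_univ, measure_empty]
  · refine ⟨Set.univ, Z₀, MeasurableSet.univ, mZ₀, by simp, hZ₀,
      (MeasurableEquiv.Set.univ _).trans e.symm, ⟨MeasurableEquiv.measurable _, ?_⟩,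
      fun a b => hjrel a b⟩
    ext B hB
    rw [MeasurableEquiv.map_apply,
      (MeasurableEmbedding.subtype_coe MeasurableSet.univ).comap_apply,
      (MeasurableEmbedding.subtype_coe mZ₀).comap_apply, hj.comap_apply]
    congr 1
    ext z
    constructor
    · rintro ⟨_, ⟨y, hy, rfl⟩, rfl⟩
      exact ⟨_, hy, rfl⟩
    · rintro ⟨b, hb, rfl⟩
      refine ⟨e b, ⟨⟨e b, trivial⟩, ?_, rfl⟩, by simp⟩
      change e.symm (e b) ∈ B
      rwa [e.symm_apply_apply]
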